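/- **Proposition 4.3 ($\partial_{E_2}$ of the MacMahon series).** Work with formal power series in $q$ over $\mathbb{C}$. For $k\ge 1$ let $$E_{2k}(q)=1-\frac{4k}{B_{2k}}\sum_{n\ge1}\sigma_{2k-1}(n)q^n ,\qquad \sigma_m(n)=\sum_{d\mid n}d^m,$$ where $B_{2k}$ are the Bernoulli numbers, and for $t\ge 0$ let $$\mathcal U_{2t}(q)=\sum_{1\le k_1<\cdots<k_t}\frac{q^{k_1+\cdots+k_t}}{(1-q^{k_1})^2\cdots(1-q^{k_t})^2},\qquad \mathcal U^{\star}_{2t}(q)=\sum_{1\le k_1\le\cdots\le k_t}\frac{q^{k_1+\cdots+k_t}}{(1-q^{k_1})^2\cdots(1-q^{k_t})^2},$$ so that $\mathcal U_0=\mathcal U_0^\star=1$. The series $E_2,E_4,E_6$ are algebraically independent over $\mathbb{C}$, so that the ring $\mathbb{C}[E_2,E_4,E_6]$ is a polynomial ring in these three generators and carries the partial derivative $\partial_{E_2}$ with respect to $E_2$ (holding $E_4,E_6$ fixed). All $\mathcal U_{2t}$ and $\mathcal U_{2t}^\star$ lie in $\mathbb{C}[E_2,E_4,E_6]$, and for every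 integer $t\ge0$ $$\partial_{E_2}\,\mathcal U_{2t}=-\frac1{12}\sum_{j=1}^{t}\frac{\mathcal U_{2t-2j}}{j^2\binom{2j}{j}} \qquad\text{and}\qquad \partial_{E_2}\,\mathcal U^{\star}_{2t}=\frac1{12}\sum_{j=1}^{t}\frac{(-1)^j\,\mathcal U^{\star}_{2t-2j}}{j^2\binom{2j}{j}} .$$ -/

import Mathlib

namespace MacMahonQM

open scoped PowerSeries ArithmeticFunction.sigma

noncomputable section

/-- The normalized Eisenstein series `E_{2k}(q) = 1 - (4k / B_{2k}) ∑_{n ≥ 1} σ_{2k-1}(n) qⁿ`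
(for `k ≥ 1`), as a formal power series in `q`; recall that `σ j 0 = 0` in Mathlib. -/
def eisensteinSeries (k : ℕ) : ℂ⟦X⟧ :=
  1 - ((4 * (k : ℂ)) / ((bernoulli (2 * k) : ℚ) : ℂ)) •
    PowerSeries.mk (fun n => ((σ (2 * k - 1) n : ℕ) : ℂ))

/-- The three generators `E_2, E_4, E_6`. -/
def gens : Fin 3 → ℂ⟦X⟧ :=
  ![eisensteinSeries 1, eisensteinSeries 2, eisensteinSeries 3]

/-- The ring `ℂ[E_2, E_4, E_6]` of quasimodular forms of level one, inside `ℂ⟦q⟧`. -/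
abbrev quasimodularRing : Subalgebra ℂ ℂ⟦X⟧ :=
  Algebra.adjoin ℂ (Set.range gens)

/-- The operator `∂/∂E_2` on `ℂ[E_2, E_4, E_6]`: identify this ring with the polynomial ring in
three variables (possible as `E_2, E_4, E_6` are algebraically independent, which is what `h` says)
and take the partial derivative with respect to the variable that corresponds to `E_2`. -/
def partialE2 (h : AlgebraicIndependent ℂ gens) (f : quasimodularRing) : quasimodularRing :=
  h.aevalEquiv (MvPolynomial.pderiv 0 (h.aevalEquiv.symm f))

/-- The summand `q^{k_1 + ⋯ + k_t} / ((1 - q^{k_1})² ⋯ (1 - q^{k_t})²)` as a formal power series. -/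
def summand {t : ℕ} (k : Fin t → ℕ+) : ℂ⟦X⟧ :=
  ∏ i, ((PowerSeries.X : ℂ⟦X⟧) ^ (k i : ℕ) * ((1 - (PowerSeries.X : ℂ⟦X⟧) ^ (k i : ℕ)) ^ 2)⁻¹)

open scoped PowerSeries.WithPiTopology in
/-- MacMahon's series `𝒰_{2t}(q)`: the sum over `1 ≤ k_1 < ⋯ < k_t`. -/
def macMahonU (t : ℕ) : ℂ⟦X⟧ :=
  ∑' k : {k : Fin t → ℕ+ // StrictMono k}, summand k.1

open scoped PowerSeries.WithPiTopology in
/-- The companion series `𝒰⋆_{2t}(q)`: the sum over `1 ≤ k_1 ≤ ⋯ ≤ k_t`. -/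
def macMahonUStar (t : ℕ) : ℂ⟦X⟧ :=
  ∑' k : {k : Fin t → ℕ+ // Monotone k}, summand k.1

theorem coeff_summand_eq_zero {t : ℕ} (k : Fin t → ℕ+) (n : ℕ) (i : Fin t) (hi : n < (k i : ℕ)) :
    PowerSeries.coeff n (summand k) = 0 := by
  have hd : (PowerSeries.X : ℂ⟦X⟧) ^ (k i : ℕ) ∣ summand k :=
    (Dvd.intro _ rfl).trans (Finset.dvd_prod_of_mem
      (fun i => (PowerSeries.X : ℂ⟦X⟧) ^ (k i : ℕ) *
        ((1 - (PowerSeries.X : ℂ⟦X⟧) ^ (k i : ℕ)) ^ 2)⁻¹) (Finset.mem_univ i))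
  exact PowerSeries.X_pow_dvd_iff.1 hd n hi

open scoped PowerSeries.WithPiTopology in
/-- The sums that define `macMahonU` and `macMahonUStar` converge. -/
theorem summable_summand (t : ℕ) (p : (Fin t → ℕ+) → Prop) :
    Summable (fun k : {k : Fin t → ℕ+ // p k} => summand k.1) := by
  rw [PowerSeries.WithPiTopology.summable_iff_summable_coeff]
  intro n
  apply summable_of_hasFiniteSupport
  have hf : (Set.pi Set.univ (fun _ : Fin t => {m : ℕ+ | (m : ℕ) ≤ n})).Finite := by
    refine Set.Finite.pi' (fun _ => ?_) |>.subset (fun k hk i => hk i (Set.mem_univ i))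
    exact (Set.finite_Iic n).preimage PNat.coe_injective.injOn
  refine (hf.preimage Subtype.val_injective.injOn).subset ?_
  intro k hk i _
  by_contra hlt
  exact hk (coeff_summand_eq_zero k.1 n i (not_le.1 hlt))

end

end MacMahonQM

/-!
`𝒰_{2t}` and `𝒰⋆_{2t}` are the elementary and the complete homogeneous symmetric functions of the
series `y_k = q^k / (1 - q^k)²`, `k ≥ 1`. The power sum `∑_k y_k^{m+1}` has the expansion
`∑_n ∑_{d ∣ n} (d + m).choose (2 m + 1) qⁿ`, and `(d + m).choose (2 m + 1)` is an odd polynomial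
in `d`, so every power sum is a linear combination of the series `∑_n σ_{2j+1}(n) qⁿ`. Only the
one with `j = 0`, which is `(1 - E_2) / 24`, involves `E_2`; hence `∂_{E_2}` sends each power sum
to a constant. Newton's identities say that the generating function `U` of the `𝒰_{2t}` satisfies
`U' = U A` with `A` the (signed) generating function of the power sums, and `∂_{E_2} U = U B`
follows, where `B' = ∂_{E_2} A` and `B(0) = 0`.

For the algebraic independence, let `P(E_2, E_4, E_6) = 0`. Transforming this under `SL(2, ℤ)`
gives a relation at each `τ` that is polynomial in `u = c τ + d`, hence holds for all `u`, and then
polynomial in `c`, so that `P(s, u⁴ E_4(τ), u⁶ E_6(τ)) = 0` for all `s` and all `u ≠ 0`. As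
`E_4³ / E_6²` takes infinitely many values, `P = 0`.
-/

namespace MacMahonQM

open scoped PowerSeries ArithmeticFunction.sigma MatrixGroups
open UpperHalfPlane ModularForm EisensteinSeries

noncomputable section

local notation "𝕢" => Function.Periodic.qParam

section NewtonIdentities

open Finset Filter Topology PowerSeries

theorem derivation_prod_of_eq_mul {ι R A : Type*} [CommSemiring R] [CommSemiring A] [Algebra R A]
    (D : Derivation R A A) {f g : ι → A} (h : ∀ a, D (f a) = f a * g a) (s : Finset ι) :
    D (∏ a ∈ s, f a) = (∏ a ∈ s, f a) * ∑ a ∈ s, g a := by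
  classical
  induction s using Finset.induction_on with
  | empty => simp
  | insert a s ha ih =>
    rw [prod_insert ha, sum_insert ha, D.leibniz, ih, h, smul_eq_mul, smul_eq_mul]
    ring

theorem succ_mul_coeff_succ_prod {ι R : Type*} [CommSemiring R] {f : ι → R⟦X⟧} {g : ι → ℕ → R}
    (h : ∀ a, d⁄dX R (f a) = f a * PowerSeries.mk (g a)) (s : Finset ι) (t : ℕ) :
    ((t : R) + 1) * coeff (t + 1) (∏ a ∈ s, f a) =
      ∑ x ∈ antidiagonal t, coeff x.1 (∏ a ∈ s, f a) * ∑ a ∈ s, g a x.2 := by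
  rw [mul_comm, ← coeff_derivative, derivation_prod_of_eq_mul _ h, coeff_mul]
  simp only [map_sum, coeff_mk]

theorem derivative_one_add_C_mul_X {R : Type*} [CommRing R] (y : R) :
    d⁄dX R (1 + C y * X) = (1 + C y * X) * PowerSeries.mk fun j => (-1) ^ j * y ^ (j + 1) := by
  ext n
  rw [add_mul, one_mul, mul_assoc]
  rcases n with _ | n
  · simp
  · simp only [map_add, Derivation.map_one_eq_zero, Derivation.leibniz, derivative_X, smul_eq_mul,
      mul_one, derivative_C, mul_zero, add_zero, zero_add, coeff_succ_C, coeff_mk, coeff_C_mul,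
      coeff_succ_X_mul]
    ring

theorem derivative_mk_pow {R : Type*} [CommSemiring R] (y : R) :
    d⁄dX R (PowerSeries.mk fun j => y ^ j) =
      (PowerSeries.mk fun j => y ^ j) * PowerSeries.mk fun j => y ^ (j + 1) := by
  ext n
  have h : ∀ x ∈ antidiagonal n, y ^ x.1 * y ^ (x.2 + 1) = y ^ (n + 1) := fun x hx => by
    rw [← pow_add, ← add_assoc, mem_antidiagonal.1 hx]
  simp only [coeff_derivative, coeff_mul, coeff_mk, sum_congr rfl h, sum_const,
    Nat.card_antidiagonal, nsmul_eq_mul]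
  push_cast
  ring

variable {α : Type*} [LinearOrder α]

open Classical in
theorem coeff_prod_one_add_C_mul_X {R : Type*} [CommSemiring R] (y : α → R) (s : Finset α)
    (t : ℕ) : coeff t (∏ a ∈ s, (1 + C (y a) * X)) =
      ∑ k ∈ Fintype.piFinset (fun _ : Fin t => s) with StrictMono k, ∏ i, y (k i) := by
  have h (u : Finset α) : coeff t (∏ a ∈ u, C (y a) * X) =
      if u.card = t then ∏ a ∈ u, y a else 0 := by
    rw [prod_mul_distrib, prod_const, ← map_prod, coeff_C_mul, coeff_X_pow]
    simp [eq_comm]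
  rw [prod_one_add, map_sum, sum_congr rfl fun u _ => h u, ← sum_filter, ← powersetCard_eq_filter]
  symm
  refine sum_bij (fun k _ => univ.image k) ?_ ?_ ?_ ?_ <;>
    simp only [mem_filter, Fintype.mem_piFinset, mem_powersetCard]
  · rintro k ⟨hks, hk⟩
    exact ⟨image_subset_iff.2 fun i _ => hks i, by simp [card_image_of_injective _ hk.injective]⟩
  · rintro k ⟨-, hk⟩ l ⟨-, hl⟩ h
    exact (hk.range_inj hl).1 (by simpa using congrArg (fun u : Finset α => (u : Set α)) h)
  · rintro u ⟨hus, hu⟩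
    exact ⟨u.orderEmbOfFin hu, ⟨fun i => hus (u.orderEmbOfFin_mem hu i),
      (u.orderEmbOfFin hu).strictMono⟩, image_orderEmbOfFin_univ u hu⟩
  · rintro k ⟨-, hk⟩
    rw [prod_image hk.injective.injOn]

open Classical in
theorem coeff_prod_mk_pow {R : Type*} [CommSemiring R] (y : α → R) (s : Finset α) (t : ℕ) :
    coeff t (∏ a ∈ s, PowerSeries.mk fun j => y a ^ j) =
      ∑ k ∈ Fintype.piFinset (fun _ : Fin t => s) with Monotone k, ∏ i, y (k i) := by
  simp only [coeff_prod, coeff_mk]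
  symm
  refine sum_bij (fun k _ => Multiset.toFinsupp (List.ofFn k : Multiset α)) ?_ ?_ ?_ ?_ <;>
    simp only [mem_filter, Fintype.mem_piFinset, mem_finsuppAntidiag']
  · rintro k ⟨hks, -⟩
    refine ⟨?_, fun a ha => ?_⟩
    · exact (Multiset.toFinsupp_sum_eq _).trans (by simp)
    · obtain ⟨i, rfl⟩ : ∃ i, k i = a := by simpa using ha
      exact hks i
  · rintro k ⟨-, hk⟩ l ⟨-, hl⟩ h
    have hperm := Multiset.coe_eq_coe.1 (Multiset.toFinsupp.injective h)
    exact List.ofFn_injective <|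
      hperm.eq_of_pairwise' hk.sortedLE_ofFn.pairwise hl.sortedLE_ofFn.pairwise
  · rintro l ⟨hl, hls⟩
    set L := (Finsupp.toMultiset l).sort
    obtain rfl : L.length = t := by
      rw [Multiset.length_sort, Finsupp.card_toMultiset]
      exact hl
    refine ⟨L.get, ⟨fun i => hls ?_, ?_⟩, ?_⟩
    · rw [← Finsupp.mem_toMultiset, ← Multiset.mem_sort (r := (· ≤ ·))]
      exact L.get_mem i
    · rw [← List.sortedLE_ofFn_iff, List.ofFn_get]
      exact (Multiset.pairwise_sort ..).sortedLE
    · rw [List.ofFn_get, Multiset.sort_eq, Finsupp.toMultiset_toFinsupp]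
  · rintro k ⟨hks, -⟩
    have h : (List.ofFn k : Multiset α).toFinset ⊆ s := fun a ha => by
      obtain ⟨i, rfl⟩ : ∃ i, k i = a := by simpa using ha
      exact hks i
    rw [← List.prod_ofFn, ← Function.comp_def y k, ← List.map_ofFn, ← Multiset.prod_coe,
      ← Multiset.map_coe, prod_multiset_map_count]
    refine prod_subset h fun a _ ha => ?_
    rw [Multiset.count_eq_zero_of_notMem (by simpa using ha), pow_zero]

theorem tendsto_sum_piFinset_filter {M : Type*} [AddCommMonoid M] [TopologicalSpace M] {t : ℕ}
    {p : (Fin t → α) → Prop} [DecidablePred p] {f : (Fin t → α) → M} {a : M}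
    (h : HasSum (fun k : {k // p k} => f k) a) :
    Tendsto (fun s => ∑ k ∈ Fintype.piFinset (fun _ => s) with p k, f k) atTop (𝓝 a) := by
  simp only [← sum_subtype_eq_sum_filter]
  refine h.comp (tendsto_atTop_finset_of_monotone (fun s u hsu => ?_) fun k => ?_)
  · exact subtype_mono (Fintype.piFinset_subset _ _ fun _ => hsu)
  · exact ⟨univ.image k.1, by simp⟩

theorem succ_mul_eq_sum_of_hasSum {R : Type*} [CommSemiring R] [TopologicalSpace R]
    [IsTopologicalSemiring R] [T2Space R] {p : ∀ t, (Fin t → α) → Prop}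
    [∀ t, DecidablePred (p t)] {y : α → R} {f : α → R⟦X⟧} {g : α → ℕ → R} {u a : ℕ → R}
    (hf : ∀ s t, coeff t (∏ a ∈ s, f a) =
      ∑ k ∈ Fintype.piFinset (fun _ : Fin t => s) with p t k, ∏ i, y (k i))
    (hg : ∀ a, d⁄dX R (f a) = f a * PowerSeries.mk (g a))
    (hu : ∀ t, HasSum (fun k : {k // p t k} => ∏ i, y (k.1 i)) (u t))
    (ha : ∀ j, HasSum (fun a => g a j) (a j)) (t : ℕ) :
    ((t : R) + 1) * u (t + 1) = ∑ x ∈ antidiagonal t, u x.1 * a x.2 := by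
  have hlim (t : ℕ) : Tendsto (fun s => coeff t (∏ a ∈ s, f a)) atTop (𝓝 (u t)) := by
    simpa only [hf] using tendsto_sum_piFinset_filter (f := fun k => ∏ i, y (k i)) (hu t)
  refine tendsto_nhds_unique ((hlim (t + 1)).const_mul _) ?_
  simp only [succ_mul_coeff_succ_prod hg]
  exact tendsto_finsetSum _ fun x _ => (hlim x.1).mul (ha x.2)

theorem newton_strictMono {R : Type*} [CommRing R] [TopologicalSpace R] [IsTopologicalRing R]
    [T2Space R] {y : α → R} {u b : ℕ → R}
    (hu : ∀ t, HasSum (fun k : {k : Fin t → α // StrictMono k} => ∏ i, y (k.1 i)) (u t))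
    (hb : ∀ j, HasSum (fun a => y a ^ (j + 1)) (b j)) (t : ℕ) :
    ((t : R) + 1) * u (t + 1) = ∑ x ∈ antidiagonal t, u x.1 * ((-1) ^ x.2 * b x.2) := by
  classical
  exact succ_mul_eq_sum_of_hasSum (coeff_prod_one_add_C_mul_X y)
    (fun a => derivative_one_add_C_mul_X (y a)) hu (fun j => (hb j).mul_left _) t

theorem newton_monotone {R : Type*} [CommSemiring R] [TopologicalSpace R]
    [IsTopologicalSemiring R] [T2Space R] {y : α → R} {u b : ℕ → R}
    (hu : ∀ t, HasSum (fun k : {k : Fin t → α // Monotone k} => ∏ i, y (k.1 i)) (u t))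
    (hb : ∀ j, HasSum (fun a => y a ^ (j + 1)) (b j)) (t : ℕ) :
    ((t : R) + 1) * u (t + 1) = ∑ x ∈ antidiagonal t, u x.1 * b x.2 := by
  classical
  exact succ_mul_eq_sum_of_hasSum (coeff_prod_mk_pow y) (fun a => derivative_mk_pow (y a)) hu hb t

end NewtonIdentities

section Factor

open scoped PowerSeries.WithPiTopology
open PowerSeries (X)

/-- The series `q^k / (1 - q^k)²`, so that `summand k = ∏ i, factor (k i)`. -/
def factor (k : ℕ+) : ℂ⟦X⟧ := X ^ (k : ℕ) * ((1 - X ^ (k : ℕ)) ^ 2)⁻¹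

/-- The power sum `∑_{k ≥ 1} (q^k / (1 - q^k)²)^{m+1}`, through its `q`-expansion. -/
def powerSum (m : ℕ) : ℂ⟦X⟧ :=
  PowerSeries.mk fun n => ∑ d ∈ n.divisors, ((d + m).choose (2 * m + 1) : ℂ)

theorem mk_choose_mul_one_sub_X_pow {R : Type*} [CommRing R] (m : ℕ) :
    PowerSeries.mk (fun n => ((n + m).choose (2 * m + 1) : R)) * (1 - X) ^ (2 * (m + 1)) =
      X ^ (m + 1) := by
  have h : PowerSeries.mk (fun n => ((n + m).choose (2 * m + 1) : R)) =
      X ^ (m + 1) * PowerSeries.mk fun n => ((2 * m + 1 + n).choose (2 * m + 1) : R) := by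
    ext n
    simp only [PowerSeries.coeff_X_pow_mul', PowerSeries.coeff_mk]
    split_ifs with hn
    · rw [show 2 * m + 1 + (n - (m + 1)) = n + m by lia]
    · rw [Nat.choose_eq_zero_of_lt (by lia), Nat.cast_zero]
  rw [h, mul_assoc, show 2 * (m + 1) = 2 * m + 1 + 1 by ring,
    PowerSeries.mk_add_choose_mul_one_sub_pow_eq_one, mul_one]

theorem factor_mul_one_sub_sq (k : ℕ+) : factor k * (1 - X ^ (k : ℕ)) ^ 2 = X ^ (k : ℕ) :=
  (PowerSeries.eq_mul_inv_iff_mul_eq (by simp)).1 rfl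

theorem factor_pow (k : ℕ+) (m : ℕ) : factor k ^ (m + 1) = PowerSeries.expand k k.ne_zero
    (PowerSeries.mk fun n => ((n + m).choose (2 * m + 1) : ℂ)) := by
  have hk : ((1 - X ^ (k : ℕ) : ℂ⟦X⟧) ^ 2) ^ (m + 1) ≠ 0 := fun h => by
    simpa using congrArg PowerSeries.constantCoeff h
  refine mul_right_cancel₀ hk ?_
  rw [← mul_pow, factor_mul_one_sub_sq, ← pow_mul (1 - X ^ (k : ℕ))]
  have h := congrArg (PowerSeries.expand k k.ne_zero) (mk_choose_mul_one_sub_X_pow (R := ℂ) m)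
  rw [map_mul, map_pow, map_pow, map_sub, map_one, PowerSeries.expand_X] at h
  exact h.symm

theorem coeff_factor_pow (k : ℕ+) (m n : ℕ) : (factor k ^ (m + 1)).coeff n =
    if (k : ℕ) ∈ n.divisors then ((n / k + m).choose (2 * m + 1) : ℂ) else 0 := by
  rw [factor_pow, PowerSeries.coeff_expand, PowerSeries.coeff_mk]
  rcases eq_or_ne n 0 with rfl | hn
  · simp [Nat.choose_eq_zero_of_lt (show m < 2 * m + 1 by lia)]
  · simp [hn]

theorem hasSum_factor_pow (m : ℕ) : HasSum (fun k => factor k ^ (m + 1)) (powerSum m) := by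
  rw [PowerSeries.WithPiTopology.hasSum_iff_hasSum_coeff]
  intro n
  simp only [coeff_factor_pow, powerSum, PowerSeries.coeff_mk]
  rw [← Nat.sum_div_divisors n fun d => ((d + m).choose (2 * m + 1) : ℂ)]
  refine (PNat.coe_injective.hasSum_iff (f := fun k => if k ∈ n.divisors then
    ((n / k + m).choose (2 * m + 1) : ℂ) else 0) fun k hk => ?_).2 ?_
  · rw [if_neg fun h => hk ⟨⟨k, Nat.pos_of_mem_divisors h⟩, rfl⟩]
  · rw [← Finset.sum_congr rfl fun k hk => if_pos hk]
    exact hasSum_sum_of_ne_finset_zero fun k hk => if_neg hk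

theorem hasSum_macMahonU (t : ℕ) : HasSum
    (fun k : {k : Fin t → ℕ+ // StrictMono k} => ∏ i, factor (k.1 i)) (macMahonU t) :=
  (summable_summand t _).hasSum

theorem hasSum_macMahonUStar (t : ℕ) : HasSum
    (fun k : {k : Fin t → ℕ+ // Monotone k} => ∏ i, factor (k.1 i)) (macMahonUStar t) :=
  (summable_summand t _).hasSum

theorem macMahonU_zero : macMahonU 0 = 1 :=
  (hasSum_macMahonU 0).unique <| by
    convert! hasSum_single (⟨![], Subsingleton.strictMono _⟩ : {k : Fin 0 → ℕ+ // StrictMono k})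
      fun k hk => (hk (Subsingleton.elim _ _)).elim

theorem macMahonUStar_zero : macMahonUStar 0 = 1 :=
  (hasSum_macMahonUStar 0).unique <| by
    convert! hasSum_single (⟨![], Subsingleton.monotone _⟩ : {k : Fin 0 → ℕ+ // Monotone k})
      fun k hk => (hk (Subsingleton.elim _ _)).elim

end Factor

section ChoosePolynomial

open Polynomial

theorem eval_descPochhammer_two_mul_add_one {R : Type*} [CommRing R] (x : R) (m : ℕ) :
    (descPochhammer R (2 * m + 1)).eval (x + m) =
      x * ∏ j ∈ Finset.range m, (x ^ 2 - ((j : R) + 1) ^ 2) := by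
  induction m with
  | zero => simp
  | succ m ih =>
    rw [show 2 * (m + 1) + 1 = 2 * m + 1 + 1 + 1 by ring, descPochhammer_succ_left, eval_mul,
      eval_X, eval_comp, eval_sub, eval_X, eval_one, Nat.cast_succ, ← add_assoc,
      add_sub_cancel_right, descPochhammer_succ_eval, ih, Finset.prod_range_succ]
    push_cast
    ring

variable (K : Type*) [Field K]

/-- The polynomial `∏_{j=1}^m (Y - j²) / (2m+1)!`, for which
`(n+m).choose (2m+1) = n * (choosePoly K m).eval (n²)`. -/
def choosePoly (m : ℕ) : K[X] :=
  C ((2 * m + 1).factorial : K)⁻¹ * ∏ j ∈ Finset.range m, (X - C (((j : K) + 1) ^ 2))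

variable [CharZero K]

theorem cast_choose_eq_eval_choosePoly (n m : ℕ) :
    ((n + m).choose (2 * m + 1) : K) = n * (choosePoly K m).eval ((n : K) ^ 2) := by
  have h := eval_descPochhammer_two_mul_add_one (n : K) m
  rw [← Nat.cast_add, descPochhammer_eval_eq_descFactorial] at h
  rw [Nat.choose_eq_descFactorial_div_factorial,
    Nat.cast_div (Nat.factorial_dvd_descFactorial ..)
      (Nat.cast_ne_zero.2 (Nat.factorial_ne_zero _)), h, choosePoly]
  simp only [eval_mul, eval_C, eval_prod, eval_sub, eval_X]
  ring

theorem coeff_zero_choosePoly (m : ℕ) : (choosePoly K m).coeff 0 =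
    2 * (-1) ^ m / (((m : K) + 1) * ((2 * (m + 1)).choose (m + 1))) := by
  have h := congrArg (Nat.cast (R := K)) (Nat.choose_mul_factorial_mul_factorial
    (show m + 1 ≤ 2 * (m + 1) by lia))
  rw [show 2 * (m + 1) - (m + 1) = m + 1 by lia, show 2 * (m + 1) = 2 * m + 1 + 1 by ring,
    Nat.factorial_succ (2 * m + 1), Nat.factorial_succ m] at h
  have hchoose : ((2 * m + 1 + 1).choose (m + 1) : K) ≠ 0 :=
    Nat.cast_ne_zero.2 (Nat.choose_pos (by lia)).ne'
  have hfact : ((2 * m + 1).factorial : K) ≠ 0 := Nat.cast_ne_zero.2 (Nat.factorial_ne_zero _)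
  have hm : (m : K) + 1 ≠ 0 := by exact_mod_cast m.succ_ne_zero
  have hprod : ∏ j ∈ Finset.range m, (0 - ((j : K) + 1) ^ 2) =
      (-1) ^ m * (m.factorial : K) ^ 2 := by
    simp [Finset.prod_neg, Finset.prod_pow, ← Finset.prod_range_add_one_eq_factorial]
  rw [coeff_zero_eq_eval_zero, choosePoly]
  simp only [eval_mul, eval_C, eval_prod, eval_sub, eval_X]
  rw [hprod, show 2 * (m + 1) = 2 * m + 1 + 1 by ring, eq_div_iff (mul_ne_zero hm hchoose)]
  push_cast at h
  field_simp
  refine mul_left_cancel₀ hm ?_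
  linear_combination h

end ChoosePolynomial

section Evaluation

theorem hasSum_coeff_mul_pow_mul {𝕜 : Type*} [RCLike 𝕜] {F G : 𝕜⟦X⟧} {q a b : 𝕜}
    (hF : HasSum (fun n => F.coeff n * q ^ n) a) (hG : HasSum (fun n => G.coeff n * q ^ n) b) :
    HasSum (fun n => (F * G).coeff n * q ^ n) (a * b) := by
  have hcoeff (n : ℕ) : (F * G).coeff n * q ^ n = ∑ x ∈ Finset.HasAntidiagonal.antidiagonal n,
      (F.coeff x.1 * q ^ x.1) * (G.coeff x.2 * q ^ x.2) := by
    rw [PowerSeries.coeff_mul, Finset.sum_mul]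
    refine Finset.sum_congr rfl fun x hx => ?_
    rw [← Finset.HasAntidiagonal.mem_antidiagonal.1 hx, pow_add]
    ring
  have hF' := hF.summable.norm
  have hG' := hG.summable.norm
  rw [funext hcoeff, ← hF.tsum_eq, ← hG.tsum_eq,
    tsum_mul_tsum_eq_tsum_sum_antidiagonal_of_summable_norm hF' hG']
  exact (summable_norm_sum_mul_antidiagonal_of_summable_norm hF' hG').of_norm.hasSum

theorem hasSum_coeff_aeval {𝕜 ι : Type*} [RCLike 𝕜] {F : ι → 𝕜⟦X⟧} {v : ι → 𝕜} {q : 𝕜}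
    (h : ∀ i, HasSum (fun n => (F i).coeff n * q ^ n) (v i)) (P : MvPolynomial ι 𝕜) :
    HasSum (fun n => (MvPolynomial.aeval F P).coeff n * q ^ n) (MvPolynomial.eval v P) := by
  induction P using MvPolynomial.induction_on with
  | C a =>
    convert! hasSum_single (f := fun n => (PowerSeries.C a).coeff n * q ^ n) 0
      fun n hn => ?_ using 1
    · simp
    · simp
    · simp [PowerSeries.coeff_C, hn]
  | add P Q hP hQ => simpa [add_mul] using hP.add hQ
  | mul_X P i hP => simpa using hasSum_coeff_mul_pow_mul hP (h i)

theorem comp_vec_three {α β : Type*} (f : α → β) (a b c : α) :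
    f ∘ ![a, b, c] = ![f a, f b, f c] := by
  funext i
  fin_cases i <;> rfl

theorem eval_polynomial_curve_eq_zero_of_infinite {ι R : Type*} [CommRing R] [IsDomain R]
    {P : MvPolynomial ι R} (g : ι → Polynomial R) {S : Set R} (hS : S.Infinite)
    (h : ∀ x ∈ S, MvPolynomial.eval (Polynomial.eval x ∘ g) P = 0) (x : R) :
    MvPolynomial.eval (Polynomial.eval x ∘ g) P = 0 := by
  have hcomp (y : R) : (MvPolynomial.aeval g P).eval y =
      MvPolynomial.eval (Polynomial.eval y ∘ g) P :=
    MvPolynomial.comp_aeval_apply (f := g) (Polynomial.aeval y) P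
  have hzero : MvPolynomial.aeval g P = 0 :=
    Polynomial.eq_zero_of_infinite_isRoot _ <| hS.mono fun y hy => (hcomp y).trans (h y hy)
  rw [← hcomp, hzero, Polynomial.eval_zero]

end Evaluation

section AlgebraicIndependence

open MvPolynomial (eval aeval)

theorem bernoulli_two_mul_ne_zero (k : ℕ) : bernoulli (2 * k) ≠ 0 := by
  rcases eq_or_ne k 0 with rfl | hk
  · simp
  intro h
  have hzeta : riemannZeta (2 * k) = 0 := by rw [riemannZeta_two_mul_nat hk, h]; simp
  refine riemannZeta_ne_zero_of_one_le_re ?_ hzeta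
  have : (1 : ℝ) ≤ k := by exact_mod_cast Nat.one_le_iff_ne_zero.2 hk
  norm_num
  linarith

theorem coeff_eisensteinSeries (k n : ℕ) : (eisensteinSeries k).coeff n =
    if n = 0 then 1 else -((4 * (k : ℂ)) / ((bernoulli (2 * k) : ℚ) : ℂ)) * σ (2 * k - 1) n := by
  rcases eq_or_ne n 0 with rfl | h <;> simp [eisensteinSeries, PowerSeries.coeff_one, *]

theorem eisensteinSeries_eq_qExpansion {k : ℕ} (hk : 3 ≤ 2 * k) :
    eisensteinSeries k = qExpansion 1 (E hk) := by
  ext n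
  rw [coeff_eisensteinSeries, E_qExpansion_coeff hk (even_two_mul k)]
  push_cast
  ring_nf

theorem gens_one : gens 1 = qExpansion 1 E₄ := eisensteinSeries_eq_qExpansion (k := 2) _

theorem gens_two : gens 2 = qExpansion 1 E₆ := eisensteinSeries_eq_qExpansion (k := 3) _

theorem coeff_zero_gens_one : (gens 1).coeff 0 = 1 := by
  rw [gens_one, E_qExpansion_coeff_zero _ ⟨2, rfl⟩]

theorem coeff_zero_gens_two : (gens 2).coeff 0 = 1 := by
  rw [gens_two, E_qExpansion_coeff_zero _ ⟨3, rfl⟩]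

theorem hasSum_qExpansion_levelOne {k : ℤ} (f : ModularForm 𝒮ℒ k) (τ : ℍ) :
    HasSum (fun n => (qExpansion 1 f).coeff n * 𝕢 1 τ ^ n) (f τ) := by
  have : Fact (IsCusp OnePoint.infty 𝒮ℒ) :=
    ⟨Subgroup.isCusp_of_mem_strictPeriods one_pos one_mem_strictPeriods_SL⟩
  exact ModularForm.hasSum_qExpansion f one_pos one_mem_strictPeriods_SL τ

theorem hasSum_gens (τ : ℍ) (i : Fin 3) :
    HasSum (fun n => (gens i).coeff n * 𝕢 1 τ ^ n) (![E2 τ, E₄ τ, E₆ τ] i) := by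
  fin_cases i
  · convert! hasSum_qExpansion_E2 (z := τ) using 2 with n
    change (eisensteinSeries 1).coeff n * _ = _
    rw [coeff_eisensteinSeries, smul_eq_mul]
    congr 1
    · norm_num [bernoulli_two]
    · simp [Function.Periodic.qParam]
  · change HasSum (fun n => (gens 1).coeff n * _) (E₄ τ)
    rw [gens_one]
    exact hasSum_qExpansion_levelOne E₄ τ
  · change HasSum (fun n => (gens 2).coeff n * _) (E₆ τ)
    rw [gens_two]
    exact hasSum_qExpansion_levelOne E₆ τ

theorem eq_zero_of_hasSum_qParam_zero {F : ℂ⟦X⟧}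
    (h : ∀ τ : ℍ, HasSum (fun n => F.coeff n * 𝕢 1 τ ^ n) 0) : F = 0 := by
  ext n
  have hcoeff := ModularFormClass.qExpansion_coeff_unique (f := (0 : ModularForm 𝒮ℒ 0)) (k := 0)
    (c := fun n => F.coeff n) one_pos one_mem_strictPeriods_SL (by simpa using h) n
  rw [hcoeff, FunLike.coe_zero, qExpansion_zero, map_zero]

theorem aeval_gens_eq_zero_iff {P : MvPolynomial (Fin 3) ℂ} :
    aeval gens P = 0 ↔ ∀ τ : ℍ, eval ![E2 τ, E₄ τ, E₆ τ] P = 0 := by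
  refine ⟨fun hP τ => ?_, fun hP => eq_zero_of_hasSum_qParam_zero fun τ => ?_⟩
  · have h := hasSum_coeff_aeval (hasSum_gens τ) P
    rw [hP] at h
    exact h.unique (by simp)
  · rw [← hP τ]
    exact hasSum_coeff_aeval (hasSum_gens τ) P

/-- The constant in the transformation law of `E2`. -/
def anomaly : ℂ := (1 / (2 * riemannZeta 2)) * (2 * Real.pi * Complex.I)

theorem anomaly_ne_zero : anomaly ≠ 0 := by
  simp [anomaly, riemannZeta_two, Real.pi_ne_zero]

theorem E2_smul (γ : SL(2, ℤ)) (τ : ℍ) :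
    E2 (γ • τ) = E2 τ * denom γ τ ^ 2 - anomaly * (γ 1 0) * denom γ τ := by
  have h := congrFun (E2_slash_action γ) τ
  have hd := denom_ne_zero γ τ
  simp only [SL_slash_apply, Pi.sub_apply, Pi.smul_apply, smul_eq_mul, D2, zpow_neg,
    zpow_ofNat] at h
  rw [anomaly]
  field_simp at h ⊢
  linear_combination h

theorem levelOne_smul {k : ℕ} (f : ModularForm 𝒮ℒ k) (γ : SL(2, ℤ)) (τ : ℍ) :
    f (γ • τ) = f τ * denom γ τ ^ k := by
  have h := congrFun (SlashInvariantFormClass.slash_action_eq f γ ⟨γ, rfl⟩) τ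
  have hd := denom_ne_zero γ τ
  rw [← SL_slash, SL_slash_apply, zpow_neg, zpow_natCast] at h
  field_simp at h
  linear_combination h

variable {P : MvPolynomial (Fin 3) ℂ}

theorem eval_modular_transform_eq_zero (hP : ∀ τ : ℍ, eval ![E2 τ, E₄ τ, E₆ τ] P = 0) (τ : ℍ)
    {c d : ℤ} (hcd : IsCoprime c d) :
    eval ![E2 τ * (c * τ + d : ℂ) ^ 2 - anomaly * c * (c * τ + d),
      E₄ τ * (c * τ + d : ℂ) ^ 4, E₆ τ * (c * τ + d : ℂ) ^ 6] P = 0 := by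
  obtain ⟨γ, hγ⟩ := hcd.exists_SL2_row 1
  have h := hP (γ • τ)
  have hd : denom γ τ = c * τ + d := by
    rw [ModularGroup.denom_apply, hγ.1, hγ.2]
  rwa [E2_smul, levelOne_smul, levelOne_smul, hd, hγ.1] at h

theorem eval_weighted_scaling_eq_zero (hP : ∀ τ : ℍ, eval ![E2 τ, E₄ τ, E₆ τ] P = 0) (τ : ℍ)
    {c : ℕ} (hc : c ≠ 0) (u : ℂ) :
    eval ![E2 τ * u ^ 2 - anomaly * c * u, E₄ τ * u ^ 4, E₆ τ * u ^ 6] P = 0 := by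
  have h := eval_polynomial_curve_eq_zero_of_infinite (P := P)
    ![.C (E2 τ) * .X ^ 2 - .C (anomaly * c) * .X,
      .C (E₄ τ) * .X ^ 4, .C (E₆ τ) * .X ^ 6]
    (S := Set.range fun n : ℕ => (c * τ + (1 + c * n : ℤ) : ℂ))
    (Set.infinite_range_of_injective fun m n hmn => by simpa [hc] using hmn) (by
      rintro _ ⟨n, rfl⟩
      simpa [comp_vec_three] using
        eval_modular_transform_eq_zero hP τ (c := c) (d := 1 + c * n) ⟨-n, 1, by ring⟩) u
  simpa [comp_vec_three] using h

theorem eval_weighted_twist_eq_zero (hP : ∀ τ : ℍ, eval ![E2 τ, E₄ τ, E₆ τ] P = 0) (τ : ℍ)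
    (s : ℂ) {u : ℂ} (hu : u ≠ 0) : eval ![s, E₄ τ * u ^ 4, E₆ τ * u ^ 6] P = 0 := by
  have h := eval_polynomial_curve_eq_zero_of_infinite (P := P)
    ![.C (E2 τ * u ^ 2) - .C (anomaly * u) * .X,
      .C (E₄ τ * u ^ 4), .C (E₆ τ * u ^ 6)]
    (S := Set.range fun n : ℕ => ((n + 1 : ℕ) : ℂ))
    (Set.infinite_range_of_injective fun m n hmn => by simpa using hmn) (by
      rintro _ ⟨n, rfl⟩
      simpa [comp_vec_three, mul_right_comm] using
        eval_weighted_scaling_eq_zero hP τ n.succ_ne_zero u)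
    ((E2 τ * u ^ 2 - s) / (anomaly * u))
  simpa [comp_vec_three, mul_div_cancel₀, anomaly_ne_zero, hu] using h

theorem infinite_setOf_E₄_cube_div_E₆_sq :
    {y : ℂ | ∃ τ : ℍ, E₄ τ ≠ 0 ∧ E₆ τ ≠ 0 ∧ y = E₄ τ ^ 3 / E₆ τ ^ 2}.Infinite := by
  intro hfin
  let Q : MvPolynomial (Fin 3) ℂ := .X 1 * .X 2 * ∏ y ∈ hfin.toFinset, (.X 1 ^ 3 - .C y * .X 2 ^ 2)
  have hQ : aeval gens Q = 0 := aeval_gens_eq_zero_iff.2 fun τ => by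
    by_cases h4 : E₄ τ = 0
    · simp [Q, h4]
    by_cases h6 : E₆ τ = 0
    · simp [Q, h6]
    have hτ : E₄ τ ^ 3 / E₆ τ ^ 2 ∈ hfin.toFinset := hfin.mem_toFinset.2 ⟨τ, h4, h6, rfl⟩
    have hprod : ∏ y ∈ hfin.toFinset, (E₄ τ ^ 3 - y * E₆ τ ^ 2) = 0 :=
      Finset.prod_eq_zero hτ (by field_simp; simp)
    simp [Q, hprod]
  have h4 : gens 1 ≠ 0 := fun h => by simpa [h] using coeff_zero_gens_one
  have h6 : gens 2 ≠ 0 := fun h => by simpa [h] using coeff_zero_gens_two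
  obtain ⟨y, -, hy⟩ : ∃ y ∈ hfin.toFinset, gens 1 ^ 3 - PowerSeries.C y * gens 2 ^ 2 = 0 := by
    simpa [Q, h4, h6, Finset.prod_eq_zero_iff, PowerSeries.algebraMap_apply] using hQ
  have h4' : (gens 1).coeff 1 = 240 := by rw [gens_one, E₄_qExpansion_coeff_one]
  have h6' : (gens 2).coeff 1 = -504 := by rw [gens_two, E₆_qExpansion_coeff_one]
  have hcoeff (n : ℕ) : (gens 1 ^ 3 - PowerSeries.C y * gens 2 ^ 2).coeff n = 0 := by simp [hy]
  have h0 := hcoeff 0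
  have h1 := hcoeff 1
  have h40 := coeff_zero_gens_one
  have h60 := coeff_zero_gens_two
  simp only [PowerSeries.coeff_zero_eq_constantCoeff] at h0 h40 h60
  -- The coefficients of `q⁰` and `q¹` give `y = 1` and `3 * 240 = y * (2 * (-504))`.
  simp only [pow_succ, pow_zero, one_mul, mul_one, map_sub, map_mul,
    PowerSeries.constantCoeff_C, PowerSeries.coeff_C_mul, PowerSeries.coeff_one_mul, h40, h60,
    h4', h6'] at h0 h1
  have : y = 1 := by linear_combination -h0
  norm_num [this] at h1

theorem eval_sq_mul_cube_mul_eq_zero (hP : ∀ τ : ℍ, eval ![E2 τ, E₄ τ, E₆ τ] P = 0) (s : ℂ)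
    {l : ℂ} (hl : l ≠ 0) (y : ℂ) : eval ![s, l ^ 2 * y, l ^ 3 * y] P = 0 := by
  have h := eval_polynomial_curve_eq_zero_of_infinite (P := P)
    ![.C s, .C (l ^ 2) * .X, .C (l ^ 3) * .X] infinite_setOf_E₄_cube_div_E₆_sq (by
      rintro _ ⟨τ, h4, h6, rfl⟩
      obtain ⟨u, hu⟩ := IsAlgClosed.exists_pow_nat_eq (l * (E₄ τ / E₆ τ)) two_pos
      have hu0 : u ≠ 0 := by
        rintro rfl
        simp_all
      have h4' : l ^ 2 * (E₄ τ ^ 3 / E₆ τ ^ 2) = E₄ τ * u ^ 4 := by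
        rw [show u ^ 4 = (u ^ 2) ^ 2 by ring, hu]
        ring
      have h6' : l ^ 3 * (E₄ τ ^ 3 / E₆ τ ^ 2) = E₆ τ * u ^ 6 := by
        rw [show u ^ 6 = (u ^ 2) ^ 3 by ring, hu]
        field_simp
      simpa [comp_vec_three, h4', h6'] using eval_weighted_twist_eq_zero hP τ s hu0) y
  simpa [comp_vec_three] using h

theorem algebraicIndependent_gens : AlgebraicIndependent ℂ gens := by
  refine algebraicIndependent_iff.2 fun P hP => ?_
  have hzero : P * (.X 1 * .X 2) = 0 := by
    refine MvPolynomial.funext fun x => ?_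
    rcases eq_or_ne (x 1) 0 with h1 | h1
    · simp [h1]
    rcases eq_or_ne (x 2) 0 with h2 | h2
    · simp [h2]
    have hx : ![x 0, (x 2 / x 1) ^ 2 * (x 1 ^ 3 / x 2 ^ 2),
        (x 2 / x 1) ^ 3 * (x 1 ^ 3 / x 2 ^ 2)] = x := by
      funext i
      fin_cases i <;> simp <;> field_simp
    have h := eval_sq_mul_cube_mul_eq_zero (aeval_gens_eq_zero_iff.1 hP) (x 0)
      (div_ne_zero h2 h1) (x 1 ^ 3 / x 2 ^ 2)
    rw [hx] at h
    simp [h]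
  simpa [MvPolynomial.X_ne_zero] using hzero

end AlgebraicIndependence

section ModularForms

theorem qExpansion_discriminant :
    qExpansion 1 ModularForm.discriminant = (1 / 1728 : ℂ) • (gens 1 ^ 3 - gens 2 ^ 2) := by
  set Δ : ModularForm 𝒮ℒ 12 := (1 / 1728 : ℂ) •
    (ModularForm.mcast (by decide) (E₄.pow 3) - ModularForm.mcast (by decide) (E₆.pow 2)) with hΔ
  have h : (ModularForm.discriminant : ℍ → ℂ) = Δ := by
    ext z
    rw [discriminant_eq_E₄_cube_sub_E₆_sq, hΔ]
    simp only [ModularForm.coe_mcast, ModularForm.coe_pow, FunLike.coe_smul, FunLike.coe_sub,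
      Pi.smul_apply, Pi.sub_apply, Pi.pow_apply, smul_eq_mul]
    ring
  rw [h, hΔ, FunLike.coe_smul, ModularForm.qExpansion_smul one_pos one_mem_strictPeriods_SL,
    FunLike.coe_sub, ModularForm.qExpansion_sub one_pos one_mem_strictPeriods_SL,
    ModularForm.qExpansion_mcast, ModularForm.qExpansion_mcast,
    ModularForm.qExpansion_pow one_pos one_mem_strictPeriods_SL,
    ModularForm.qExpansion_pow one_pos one_mem_strictPeriods_SL, gens_one, gens_two]

/-- The ring `ℂ[E_4, E_6]` of modular forms of level one, inside `ℂ⟦q⟧`. -/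
abbrev modularRing : Subalgebra ℂ ℂ⟦X⟧ := Algebra.adjoin ℂ {gens 1, gens 2}

theorem gens_one_mem_modularRing : gens 1 ∈ modularRing := Algebra.subset_adjoin (by simp)

theorem gens_two_mem_modularRing : gens 2 ∈ modularRing := Algebra.subset_adjoin (by simp)

theorem exists_qExpansion_mem_modularRing_coeff_zero_eq_one {k : ℤ} (hk : 0 ≤ k)
    (heven : Even k) (h2 : k ≠ 2) : ∃ M : ModularForm 𝒮ℒ k,
      qExpansion 1 M ∈ modularRing ∧ (qExpansion 1 M).coeff 0 = 1 := by
  obtain ⟨a, b, hab⟩ : ∃ a b : ℕ, (a : ℤ) * 4 + b * 6 = k := by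
    obtain ⟨m, rfl⟩ := heven
    lift m to ℕ using by lia
    rcases Nat.even_or_odd m with ⟨r, hr⟩ | ⟨r, hr⟩
    · exact ⟨r, 0, by lia⟩
    · exact ⟨r - 1, 1, by lia⟩
  have hM : qExpansion 1 (ModularForm.mcast (by simpa using hab) ((E₄.pow a).mul (E₆.pow b)) :
      ModularForm 𝒮ℒ k) = gens 1 ^ a * gens 2 ^ b := by
    rw [ModularForm.qExpansion_mcast, ModularForm.qExpansion_mul one_pos one_mem_strictPeriods_SL,
      ModularForm.qExpansion_pow one_pos one_mem_strictPeriods_SL,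
      ModularForm.qExpansion_pow one_pos one_mem_strictPeriods_SL, gens_one, gens_two]
  refine ⟨_, hM ▸ mul_mem (pow_mem gens_one_mem_modularRing _)
    (pow_mem gens_two_mem_modularRing _), ?_⟩
  have h4 := coeff_zero_gens_one
  have h6 := coeff_zero_gens_two
  rw [PowerSeries.coeff_zero_eq_constantCoeff] at h4 h6 ⊢
  rw [hM]
  simp [h4, h6]

theorem qExpansion_mem_modularRing {k : ℤ} (f : ModularForm 𝒮ℒ k) :
    qExpansion 1 f ∈ modularRing := by
  induction k using Int.strongRec (m := 0) with
  | lt k hk => simp [ModularFormClass.levelOne_neg_weight_eq_zero hk f, qExpansion_zero]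
  | ge k hk ih =>
    rcases Int.even_or_odd k with heven | hodd
    swap
    · simp [ModularForm.levelOne_odd_weight_eq_zero hodd f, qExpansion_zero]
    by_cases h2 : k = 2
    · subst h2
      simp [rank_zero_iff_forall_zero.1 levelOne_weight_two_rank_zero f, qExpansion_zero]
    obtain ⟨M, hM, hM0⟩ := exists_qExpansion_mem_modularRing_coeff_zero_eq_one hk heven h2
    set c := (qExpansion 1 f).coeff 0 with hc
    have hsub : qExpansion 1 (f - c • M : ModularForm 𝒮ℒ k) =
        qExpansion 1 f - c • qExpansion 1 M := by
      rw [FunLike.coe_sub, ModularForm.qExpansion_sub one_pos one_mem_strictPeriods_SL,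
        FunLike.coe_smul, ModularForm.qExpansion_smul one_pos one_mem_strictPeriods_SL]
    have h0 : (qExpansion 1 (f - c • M : ModularForm 𝒮ℒ k)).coeff 0 = 0 := by
      rw [hsub, map_sub, PowerSeries.coeff_smul, hM0, ← hc, smul_eq_mul, mul_one, sub_self]
    have hmem : qExpansion 1 (f - c • M : ModularForm 𝒮ℒ k) ∈ modularRing := by
      rw [qExpansion_eq_qExpansion_discriminant_mul _ h0, qExpansion_discriminant]
      exact mul_mem (Subalgebra.smul_mem _ (sub_mem (pow_mem gens_one_mem_modularRing _)
        (pow_mem gens_two_mem_modularRing _)) _) (ih (k - 12) (by lia) _)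
    rw [hsub] at hmem
    simpa using add_mem hmem (Subalgebra.smul_mem _ hM c)

theorem eisensteinSeries_mem_modularRing {k : ℕ} (hk : 2 ≤ k) :
    eisensteinSeries k ∈ modularRing := by
  rw [eisensteinSeries_eq_qExpansion (by lia)]
  exact qExpansion_mem_modularRing _

end ModularForms

section Derivation

open Finset.HasAntidiagonal (antidiagonal mem_antidiagonal)

variable {K A : Type*} [Field K] [CharZero K] [CommRing A] [Algebra K A] {u a : ℕ → A}

theorem mem_of_newton {S : Subalgebra K A} (h0 : u 0 ∈ S)
    (hu : ∀ t : ℕ, ((t : A) + 1) * u (t + 1) = ∑ x ∈ antidiagonal t, u x.1 * a x.2)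
    (ha : ∀ j, a j ∈ S) (t : ℕ) : u t ∈ S := by
  induction t using Nat.strong_induction_on with
  | h t ih =>
    rcases t with _ | t
    · exact h0
    have hmem : ((t : K) + 1) • u (t + 1) ∈ S := by
      rw [Algebra.smul_def, map_add, map_natCast, map_one, hu t]
      exact sum_mem fun x hx => mul_mem (ih x.1 (by have := mem_antidiagonal.1 hx; lia)) (ha x.2)
    simpa [smul_smul, inv_mul_cancel₀ (Nat.cast_add_one_ne_zero (R := K) t)] using
      S.smul_mem hmem ((t : K) + 1)⁻¹

theorem derivation_eq_coeff_mul_of_newton (D : Derivation K A A) {B : A⟦X⟧} (h0 : u 0 = 1)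
    (hu : ∀ t : ℕ, ((t : A) + 1) * u (t + 1) = ∑ x ∈ antidiagonal t, u x.1 * a x.2)
    (hB : B.coeff 0 = 0) (ha : ∀ j, D (a j) = (d⁄dX A B).coeff j) (t : ℕ) :
    D (u t) = (PowerSeries.mk u * B).coeff t := by
  have hderiv : d⁄dX A (PowerSeries.mk u) = PowerSeries.mk u * PowerSeries.mk a := by
    ext t
    simp only [PowerSeries.coeff_derivative, PowerSeries.coeff_mul, PowerSeries.coeff_mk, ← hu t,
      mul_comm]
  induction t using Nat.strong_induction_on with
  | h t ih =>
    rcases t with _ | t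
    · simp_all
    have hunit : IsUnit ((t : A) + 1) := by
      simpa using (Nat.cast_add_one_ne_zero (R := K) t).isUnit.map (algebraMap K A)
    refine hunit.mul_left_cancel ?_
    calc ((t : A) + 1) * D (u (t + 1))
        = D (((t : A) + 1) * u (t + 1)) := by simp
      _ = ∑ x ∈ antidiagonal t, (u x.1 * D (a x.2) + D (u x.1) * a x.2) := by
        simp [hu t, mul_comm (a _)]
      _ = (PowerSeries.mk u * d⁄dX A B + PowerSeries.mk u * B * PowerSeries.mk a).coeff
          t := by
        rw [map_add, PowerSeries.coeff_mul, PowerSeries.coeff_mul, ← Finset.sum_add_distrib]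
        refine Finset.sum_congr rfl fun x hx => ?_
        rw [ha, ih x.1 (by have := mem_antidiagonal.1 hx; lia), PowerSeries.coeff_mk,
          PowerSeries.coeff_mk]
      _ = (d⁄dX A (PowerSeries.mk u * B)).coeff t := by
        rw [Derivation.leibniz, hderiv, smul_eq_mul, smul_eq_mul]
        ring_nf
      _ = ((t : A) + 1) * (PowerSeries.mk u * B).coeff (t + 1) := by
        rw [PowerSeries.coeff_derivative, mul_comm]

theorem derivation_eq_sum_of_newton (D : Derivation K A A) {b : ℕ → K} (h0 : u 0 = 1)
    (hu : ∀ t : ℕ, ((t : A) + 1) * u (t + 1) = ∑ x ∈ antidiagonal t, u x.1 * a x.2)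
    (ha : ∀ j : ℕ, D (a j) = algebraMap K A ((j + 1) * b (j + 1))) (t : ℕ) :
    D (u t) = ∑ j ∈ Finset.Icc 1 t, b j • u (t - j) := by
  let B : A⟦X⟧ := PowerSeries.mk fun j => if j = 0 then 0 else algebraMap K A (b j)
  rw [derivation_eq_coeff_mul_of_newton D (B := B) h0 hu (by simp [B]) (fun j => ?_) t, mul_comm,
    PowerSeries.coeff_mul, Finset.Nat.sum_antidiagonal_eq_sum_range_succ_mk, Finset.range_eq_Ico,
    Finset.sum_eq_sum_Ico_succ_bot t.succ_pos]
  · simp only [B, PowerSeries.coeff_mk, if_true, zero_mul, zero_add]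
    refine Finset.sum_congr rfl fun j hj => ?_
    rw [if_neg (by have := Finset.mem_Icc.1 hj; lia), Algebra.smul_def]
  · simp [B, ha, PowerSeries.coeff_derivative, mul_comm]

end Derivation

section PartialE2

theorem modularRing_le_quasimodularRing : modularRing ≤ quasimodularRing :=
  Algebra.adjoin_mono (Set.insert_subset ⟨1, rfl⟩ (Set.singleton_subset_iff.2 ⟨2, rfl⟩))

theorem gens_mem (i : Fin 3) : gens i ∈ quasimodularRing := Algebra.subset_adjoin ⟨i, rfl⟩

theorem eisensteinSeries_mem {k : ℕ} (hk : k ≠ 0) : eisensteinSeries k ∈ quasimodularRing := by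
  rcases eq_or_ne k 1 with rfl | hk1
  · exact gens_mem 0
  · exact modularRing_le_quasimodularRing (eisensteinSeries_mem_modularRing (by lia))

/-- The operator `partialE2 h` as a derivation of `ℂ[E_2, E_4, E_6]`. -/
def partialE2Derivation (h : AlgebraicIndependent ℂ gens) :
    Derivation ℂ quasimodularRing quasimodularRing :=
  Derivation.mk' (h.aevalEquiv.toLinearMap ∘ₗ (MvPolynomial.pderiv 0).toLinearMap ∘ₗ
    h.aevalEquiv.symm.toLinearMap) fun f g => by simp

theorem partialE2Derivation_apply (h : AlgebraicIndependent ℂ gens) (f : quasimodularRing) :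
    partialE2Derivation h f = partialE2 h f := rfl

theorem partialE2Derivation_gens (h : AlgebraicIndependent ℂ gens) (i : Fin 3) :
    partialE2Derivation h ⟨gens i, gens_mem i⟩ = if i = 0 then 1 else 0 := by
  have hi : h.aevalEquiv.symm ⟨gens i, gens_mem i⟩ = .X i := by
    rw [AlgEquiv.symm_apply_eq]
    ext1
    simp
  rw [partialE2Derivation_apply, partialE2, hi, MvPolynomial.pderiv_X, Pi.single_apply]
  simp [eq_comm, apply_ite]

theorem partialE2Derivation_eq_zero_of_mem_modularRing (h : AlgebraicIndependent ℂ gens)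
    {F : ℂ⟦X⟧} (hF : F ∈ modularRing) :
    partialE2Derivation h ⟨F, modularRing_le_quasimodularRing hF⟩ = 0 := by
  induction hF using Algebra.adjoin_induction with
  | mem F hF =>
    rcases hF with rfl | rfl
    · exact partialE2Derivation_gens h 1
    · exact partialE2Derivation_gens h 2
  | algebraMap r => exact (partialE2Derivation h).map_algebraMap r
  | add F G hF hG ihF ihG =>
    exact ((partialE2Derivation h).map_add ⟨F, modularRing_le_quasimodularRing hF⟩
      ⟨G, modularRing_le_quasimodularRing hG⟩).trans (by rw [ihF, ihG, add_zero])
  | mul F G hF hG ihF ihG =>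
    exact ((partialE2Derivation h).leibniz ⟨F, modularRing_le_quasimodularRing hF⟩
      ⟨G, modularRing_le_quasimodularRing hG⟩).trans (by rw [ihF, ihG]; simp)

end PartialE2

section MacMahon

/-- The series `∑_{n ≥ 1} σ_{2k-1}(n) qⁿ`. -/
def sigmaSeries (k : ℕ) : ℂ⟦X⟧ := PowerSeries.mk (fun n => ((σ (2 * k - 1) n : ℕ) : ℂ))

theorem sigmaSeries_eq {k : ℕ} (hk : k ≠ 0) : sigmaSeries k =
    ((bernoulli (2 * k) : ℚ) / (4 * k) : ℂ) • (1 - eisensteinSeries k) := by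
  have hb : ((bernoulli (2 * k) : ℚ) : ℂ) ≠ 0 := by exact_mod_cast bernoulli_two_mul_ne_zero k
  have hk' : (k : ℂ) ≠ 0 := by exact_mod_cast hk
  rw [eisensteinSeries, ← sigmaSeries, sub_sub_cancel, smul_smul]
  field_simp
  simp

theorem sigmaSeries_mem {k : ℕ} (hk : k ≠ 0) : sigmaSeries k ∈ quasimodularRing := by
  rw [sigmaSeries_eq hk]
  exact Subalgebra.smul_mem _ (sub_mem (one_mem _) (eisensteinSeries_mem hk)) _

theorem partialE2Derivation_sigmaSeries (h : AlgebraicIndependent ℂ gens) {k : ℕ} (hk : k ≠ 0) :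
    partialE2Derivation h ⟨sigmaSeries k, sigmaSeries_mem hk⟩ =
      algebraMap ℂ _ (if k = 1 then -1 / 24 else 0) := by
  have hE : partialE2Derivation h ⟨eisensteinSeries k, eisensteinSeries_mem hk⟩ =
      if k = 1 then 1 else 0 := by
    split_ifs with hk1
    · subst hk1
      exact partialE2Derivation_gens h 0
    · exact partialE2Derivation_eq_zero_of_mem_modularRing h
        (eisensteinSeries_mem_modularRing (by lia))
  have hσ : (⟨sigmaSeries k, sigmaSeries_mem hk⟩ : quasimodularRing) =
      ((bernoulli (2 * k) : ℚ) / (4 * k) : ℂ) •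
        (1 - ⟨eisensteinSeries k, eisensteinSeries_mem hk⟩) := Subtype.ext (sigmaSeries_eq hk)
  rw [hσ, Derivation.map_smul, map_sub, Derivation.map_one_eq_zero, hE]
  split_ifs with hk1
  · subst hk1
    rw [zero_sub, smul_neg, ← _root_.neg_smul, ← Algebra.algebraMap_eq_smul_one]
    norm_num [bernoulli_two]
  · simp

theorem powerSum_eq_sum_sigmaSeries (m : ℕ) : powerSum m =
    ∑ j ∈ Finset.range ((choosePoly ℂ m).natDegree + 1),
      (choosePoly ℂ m).coeff j • sigmaSeries (j + 1) := by
  ext n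
  simp only [powerSum, sigmaSeries, map_sum, PowerSeries.coeff_smul, PowerSeries.coeff_mk,
    ArithmeticFunction.sigma_apply, Nat.cast_sum, smul_eq_mul, Finset.mul_sum]
  rw [Finset.sum_comm]
  refine Finset.sum_congr rfl fun d _ => ?_
  rw [cast_choose_eq_eval_choosePoly, Polynomial.eval_eq_sum_range, Finset.mul_sum]
  refine Finset.sum_congr rfl fun j _ => ?_
  rw [show 2 * (j + 1) - 1 = 2 * j + 1 by lia]
  push_cast
  ring

theorem powerSum_mem (m : ℕ) : powerSum m ∈ quasimodularRing := by
  rw [powerSum_eq_sum_sigmaSeries]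
  exact sum_mem fun j _ => Subalgebra.smul_mem _ (sigmaSeries_mem j.succ_ne_zero) _

theorem partialE2Derivation_powerSum (h : AlgebraicIndependent ℂ gens) (m : ℕ) :
    partialE2Derivation h ⟨powerSum m, powerSum_mem m⟩ =
      algebraMap ℂ _ (-1 / 12 * (-1) ^ m / (((m : ℂ) + 1) * ((2 * (m + 1)).choose (m + 1)))) := by
  have hsum : (⟨powerSum m, powerSum_mem m⟩ : quasimodularRing) =
      ∑ j ∈ Finset.range ((choosePoly ℂ m).natDegree + 1),
        (choosePoly ℂ m).coeff j • ⟨sigmaSeries (j + 1), sigmaSeries_mem j.succ_ne_zero⟩ :=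
    Subtype.ext <| by simpa using powerSum_eq_sum_sigmaSeries m
  rw [hsum, map_sum, Finset.sum_eq_single_of_mem 0 (by simp) fun j _ hj => ?_]
  · rw [Derivation.map_smul, partialE2Derivation_sigmaSeries h (Nat.succ_ne_zero _), if_pos rfl,
      Algebra.smul_def, ← map_mul, coeff_zero_choosePoly]
    ring_nf
  · rw [Derivation.map_smul, partialE2Derivation_sigmaSeries h (Nat.succ_ne_zero _),
      if_neg (by lia), map_zero, smul_zero]

open Finset.HasAntidiagonal (antidiagonal)

open scoped PowerSeries.WithPiTopology in
theorem succ_mul_macMahonU_succ (t : ℕ) : ((t : ℂ⟦X⟧) + 1) * macMahonU (t + 1) =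
    ∑ x ∈ antidiagonal t, macMahonU x.1 * ((-1) ^ x.2 * powerSum x.2) :=
  newton_strictMono hasSum_macMahonU hasSum_factor_pow t

open scoped PowerSeries.WithPiTopology in
theorem succ_mul_macMahonUStar_succ (t : ℕ) : ((t : ℂ⟦X⟧) + 1) * macMahonUStar (t + 1) =
    ∑ x ∈ antidiagonal t, macMahonUStar x.1 * powerSum x.2 :=
  newton_monotone hasSum_macMahonUStar hasSum_factor_pow t

theorem macMahonU_mem (t : ℕ) : macMahonU t ∈ quasimodularRing :=
  mem_of_newton (u := macMahonU) (a := fun j => (-1) ^ j * powerSum j)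
    (by rw [macMahonU_zero]; exact one_mem _) succ_mul_macMahonU_succ
    (fun j => mul_mem (pow_mem (neg_mem (one_mem _)) j) (powerSum_mem j)) t

theorem macMahonUStar_mem (t : ℕ) : macMahonUStar t ∈ quasimodularRing :=
  mem_of_newton (u := macMahonUStar) (by rw [macMahonUStar_zero]; exact one_mem _)
    succ_mul_macMahonUStar_succ powerSum_mem t

theorem partialE2_macMahonU (h : AlgebraicIndependent ℂ gens) (t : ℕ) :
    partialE2 h ⟨macMahonU t, macMahonU_mem t⟩ = ∑ j ∈ Finset.Icc 1 t,
      (-(1 / 12) * (1 / ((j : ℂ) ^ 2 * ((2 * j).choose j : ℂ)))) •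
        (⟨macMahonU (t - j), macMahonU_mem (t - j)⟩ : quasimodularRing) := by
  rw [← partialE2Derivation_apply]
  refine derivation_eq_sum_of_newton (partialE2Derivation h)
    (u := fun t => ⟨macMahonU t, macMahonU_mem t⟩)
    (b := fun j => -(1 / 12) * (1 / ((j : ℂ) ^ 2 * ((2 * j).choose j : ℂ))))
    (a := fun j => (-1 : ℂ) ^ j • ⟨powerSum j, powerSum_mem j⟩)
    (Subtype.ext macMahonU_zero) (fun t => Subtype.ext ?_) (fun j => ?_) t
  · simpa [Algebra.smul_def] using succ_mul_macMahonU_succ t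
  · rw [Derivation.map_smul, partialE2Derivation_powerSum, Algebra.smul_def, ← map_mul]
    have hsign : (-1 : ℂ) ^ j * (-1) ^ j = 1 := by rw [← mul_pow]; simp
    have hj : (j : ℂ) + 1 ≠ 0 := Nat.cast_add_one_ne_zero j
    have hchoose : ((2 * (j + 1)).choose (j + 1) : ℂ) ≠ 0 :=
      Nat.cast_ne_zero.2 (Nat.choose_pos (by lia)).ne'
    congr 1
    push_cast
    field_simp
    linear_combination -hsign

theorem partialE2_macMahonUStar (h : AlgebraicIndependent ℂ gens) (t : ℕ) :
    partialE2 h ⟨macMahonUStar t, macMahonUStar_mem t⟩ = ∑ j ∈ Finset.Icc 1 t,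
      (1 / 12 * ((-1) ^ j / ((j : ℂ) ^ 2 * ((2 * j).choose j : ℂ)))) •
        (⟨macMahonUStar (t - j), macMahonUStar_mem (t - j)⟩ : quasimodularRing) := by
  rw [← partialE2Derivation_apply]
  refine derivation_eq_sum_of_newton (partialE2Derivation h)
    (u := fun t => ⟨macMahonUStar t, macMahonUStar_mem t⟩)
    (b := fun j => 1 / 12 * ((-1) ^ j / ((j : ℂ) ^ 2 * ((2 * j).choose j : ℂ))))
    (a := fun j => ⟨powerSum j, powerSum_mem j⟩)
    (Subtype.ext macMahonUStar_zero) (fun t => Subtype.ext ?_) (fun j => ?_) t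
  · simpa using succ_mul_macMahonUStar_succ t
  · rw [partialE2Derivation_powerSum]
    have hj : (j : ℂ) + 1 ≠ 0 := Nat.cast_add_one_ne_zero j
    congr 1
    push_cast
    field_simp
    ring

end MacMahon

end

end MacMahonQM

theorem proposition4p3 :
    ∃ (hE : AlgebraicIndependent ℂ MacMahonQM.gens)
      (hU : ∀ t : ℕ, MacMahonQM.macMahonU t ∈ MacMahonQM.quasimodularRing)
      (hV : ∀ t : ℕ, MacMahonQM.macMahonUStar t ∈ MacMahonQM.quasimodularRing),
      ∀ t : ℕ,
        MacMahonQM.partialE2 hE ⟨MacMahonQM.macMahonU t, hU t⟩ =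
            (-(1 / 12) : ℂ) • ∑ j ∈ Finset.Icc 1 t,
              (1 / ((j : ℂ) ^ 2 * ((2 * j).choose j : ℂ))) •
                (⟨MacMahonQM.macMahonU (t - j), hU (t - j)⟩ : MacMahonQM.quasimodularRing) ∧
        MacMahonQM.partialE2 hE ⟨MacMahonQM.macMahonUStar t, hV t⟩ =
            (1 / 12 : ℂ) • ∑ j ∈ Finset.Icc 1 t,
              ((-1) ^ j / ((j : ℂ) ^ 2 * ((2 * j).choose j : ℂ))) •
                (⟨MacMahonQM.macMahonUStar (t - j), hV (t - j)⟩ :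
                  MacMahonQM.quasimodularRing) := by
  refine ⟨MacMahonQM.algebraicIndependent_gens, MacMahonQM.macMahonU_mem,
    MacMahonQM.macMahonUStar_mem, fun t => ⟨?_, ?_⟩⟩
  · simp only [MacMahonQM.partialE2_macMahonU, Finset.smul_sum, smul_smul]
  · simp only [MacMahonQM.partialE2_macMahonUStar, Finset.smul_sum, smul_smul]
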